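/- Let $G$ be an unweighted linear graph (path) on $n$ vertices, i.e. a connected simple graph in which two vertices have degree one and all remaining vertices have degree two. In the matching game of $G$ the players are the vertices and the value $v(S)$ of a coalition $S$ is the maximum size of a matching in the subgraph of $G$ induced by $S$. The Shapley value of a player $i$ is $$\varphi_i=\frac1{n!}\sum_{S\subseteq V(G)\setminus\{i\}}|S|!\,(n-|S|-1)!\,\bigl(v(S\cup\{i\})-v(S)\bigr).$$ There is an algorithm that, given any such graph $G$ (with vertices labelled $0,\dots,n-1$ in arbitrary order, as an adjacency matrix, together with $n$) and any vertex $i$ of $G$, computes $\varphi_i$ exactly, as a fraction of two natural numbers with non-zero denominator, in time $O(n^4)$. Here an algorithm is one fixed program, independent of $n$, $G$ and $i$, of a random access machine over the natural numbers, whose unit-cost operations are assignment of constants, addition, truncated subtraction, indirect reading and writing of memory cells, and tests for zero (in branches and while-loops); time is the number of operations executed. -/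

import Mathlib

namespace PathShapley

/-! ### Cooperative games, the Shapley value, matching games, linear graphs -/

/-- The Shapley value of player `i` in the cooperative game with player set `V` and
characteristic function `v`:
`(1 / |V|!) * ∑_{S ⊆ V \ {i}} |S|! (|V| - |S| - 1)! (v (S ∪ {i}) - v S)`. -/
noncomputable def shapleyValue {V : Type*} [Fintype V] [DecidableEq V]
    (v : Finset V → ℝ) (i : V) : ℝ :=
  (∑ S ∈ (Finset.univ.erase i).powerset,
    (Nat.factorial S.card : ℝ) * (Nat.factorial (Fintype.card V - S.card - 1) : ℝ) *
      (v (insert i S) - v S)) / (Nat.factorial (Fintype.card V) : ℝ)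

open Classical in
/-- The total weight of the edges of a subgraph. -/
noncomputable def weight {V : Type*} [Fintype V] {G : SimpleGraph V}
    (w : Sym2 V → NNReal) (M : G.Subgraph) : ℝ :=
  ∑ e ∈ M.edgeSet.toFinset, (w e : ℝ)

/-- The weights of the matchings of the subgraph of `G` induced by `S`
(equivalently: of the matchings of `G` all of whose vertices lie in `S`). -/
def matchingWeights {V : Type*} [Fintype V] (G : SimpleGraph V) (w : Sym2 V → NNReal)
    (S : Finset V) : Set ℝ :=
  {x | ∃ M : G.Subgraph, M.IsMatching ∧ M.verts ⊆ (S : Set V) ∧ x = weight w M}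

/-- The matching game of the weighted graph `(G, w)`: the value of a coalition `S` is the weight
of a maximum weight matching of the subgraph induced by `S`. Only the values of `w` on edges
of `G` matter. -/
noncomputable def matchingGame {V : Type*} [Fintype V] (G : SimpleGraph V)
    (w : Sym2 V → NNReal) (S : Finset V) : ℝ :=
  sSup (matchingWeights G w S)

/-- The supremum in `matchingGame` is a maximum. -/
theorem matchingGame_isGreatest {V : Type*} [Fintype V] (G : SimpleGraph V)
    (w : Sym2 V → NNReal) (S : Finset V) :
    IsGreatest (matchingWeights G w S) (matchingGame G w S) := by
  have hfin : (matchingWeights G w S).Finite := by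
    refine (Set.finite_range (fun M : G.Subgraph => weight w M)).subset ?_
    rintro x ⟨M, -, -, rfl⟩
    exact ⟨M, rfl⟩
  have hne : (matchingWeights G w S).Nonempty :=
    ⟨_, ⊥, fun v hv => absurd hv (by simp), by simp, rfl⟩
  exact ⟨hne.csSup_mem hfin, fun x hx => le_csSup hfin.bddAbove hx⟩

/-- The unweighted matching game: all edge weights are `1`. -/
noncomputable def unweightedMatchingGame {V : Type*} [Fintype V] (G : SimpleGraph V) :
    Finset V → ℝ :=
  matchingGame G (fun _ => 1)

/-- A linear graph (path): a connected graph in which two vertices have degree one and all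
remaining vertices have degree two. -/
def IsLinearGraph {V : Type*} [Fintype V] (G : SimpleGraph V) [DecidableRel G.Adj] : Prop :=
  G.Connected ∧ ∃ a b : V, a ≠ b ∧ G.degree a = 1 ∧ G.degree b = 1 ∧
    ∀ c : V, c ≠ a → c ≠ b → G.degree c = 2

/-! ### A random access machine with a step count -/

/-- A configuration of the machine: registers and an array memory, all holding naturals.
A program is a finite text, so it names only finitely many registers; memory cells are addressed
by the contents of registers. -/
structure State where
  reg : ℕ → ℕ
  mem : ℕ → ℕ

/-- Assign the value `x` to the register `d`. -/
def State.setReg (σ : State) (d x : ℕ) : State :=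
  { σ with reg := Function.update σ.reg d x }

/-- Assign the value `x` to the memory cell with address `a`. -/
def State.setMem (σ : State) (a x : ℕ) : State :=
  { σ with mem := Function.update σ.mem a x }

/-- Programs. The only arithmetic operations are addition and truncated subtraction;
multiplication and division have to be programmed. -/
inductive Prog where
  | /-- do nothing -/
    skip : Prog
  | /-- `R_d := c` for a constant `c` -/
    const (d c : ℕ) : Prog
  | /-- `R_d := R_a + R_b` -/
    add (d a b : ℕ) : Prog
  | /-- `R_d := max (R_a - R_b) 0` -/
    sub (d a b : ℕ) : Prog
  | /-- `R_d := M[R_a]` -/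
    load (d a : ℕ) : Prog
  | /-- `M[R_a] := R_b` -/
    store (a b : ℕ) : Prog
  | /-- first `p`, then `q` -/
    seq (p q : Prog) : Prog
  | /-- if `R_a ≠ 0` then `p` else `q` -/
    ite (a : ℕ) (p q : Prog) : Prog
  | /-- while `R_a ≠ 0` do `p` -/
    loop (a : ℕ) (p : Prog) : Prog

/-- `Exec p σ τ t`: started in `σ`, the program `p` halts in `τ` after exactly `t` steps.
Every elementary instruction and every evaluation of a test is one step. -/
inductive Exec : Prog → State → State → ℕ → Prop where
  | skip (σ : State) : Exec Prog.skip σ σ 1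
  | const (σ : State) (d c : ℕ) : Exec (Prog.const d c) σ (σ.setReg d c) 1
  | add (σ : State) (d a b : ℕ) :
      Exec (Prog.add d a b) σ (σ.setReg d (σ.reg a + σ.reg b)) 1
  | sub (σ : State) (d a b : ℕ) :
      Exec (Prog.sub d a b) σ (σ.setReg d (σ.reg a - σ.reg b)) 1
  | load (σ : State) (d a : ℕ) :
      Exec (Prog.load d a) σ (σ.setReg d (σ.mem (σ.reg a))) 1
  | store (σ : State) (a b : ℕ) :
      Exec (Prog.store a b) σ (σ.setMem (σ.reg a) (σ.reg b)) 1
  | seq {p q : Prog} {σ τ υ : State} {s t : ℕ} :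
      Exec p σ τ s → Exec q τ υ t → Exec (Prog.seq p q) σ υ (s + t)
  | ite_true {a : ℕ} {p q : Prog} {σ τ : State} {t : ℕ} :
      σ.reg a ≠ 0 → Exec p σ τ t → Exec (Prog.ite a p q) σ τ (t + 1)
  | ite_false {a : ℕ} {p q : Prog} {σ τ : State} {t : ℕ} :
      σ.reg a = 0 → Exec q σ τ t → Exec (Prog.ite a p q) σ τ (t + 1)
  | loop_done {a : ℕ} {p : Prog} {σ : State} :
      σ.reg a = 0 → Exec (Prog.loop a p) σ σ 1
  | loop_step {a : ℕ} {p : Prog} {σ τ υ : State} {s t : ℕ} :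
      σ.reg a ≠ 0 → Exec p σ τ s → Exec (Prog.loop a p) τ υ t →
        Exec (Prog.loop a p) σ υ (s + t + 1)

/-- The initial configuration for a graph `G` on the vertices `0, …, n - 1` and a player `i`:
`R_0 = n`, `R_1 = i`, the memory holds the adjacency matrix of `G` row by row
(`M[u * n + v] = 1` if `u` and `v` are adjacent), and everything else is `0`. -/
def inputState {n : ℕ} (G : SimpleGraph (Fin n)) [DecidableRel G.Adj] (i : Fin n) : State where
  reg := fun r => if r = 0 then n else if r = 1 then (i : ℕ) else 0
  mem := fun k =>
    if ∃ u v : Fin n, k = (u : ℕ) * n + (v : ℕ) ∧ G.Adj u v then 1 else 0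

/-- The configuration `τ` holds the number `x` as output: `x` is the fraction with numerator
`R_0` and non-zero denominator `R_1`. -/
def Outputs (τ : State) (x : ℝ) : Prop :=
  τ.reg 1 ≠ 0 ∧ x = (τ.reg 0 : ℝ) / (τ.reg 1 : ℝ)

end PathShapley

/-! Number the vertices of the path `0, …, n - 1` and let `i` have position `p`. Scanning a
coalition from the left and taking every available edge gives a maximum matching. In a run of
present vertices the scan takes every second edge, so the indicator that `{x - 1, x}` is taken is an
alternating sum, over `l < x`, of the indicators that all positions `l, …, x` are present
(`greedy_indicator`). Hence the matching game is a combination of unanimity games of intervals, with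
signs `(-1) ^ (x - l + 1)` (`unweightedMatchingGame_eq_sum`).

The Shapley value is linear, and in the unanimity game of `T` each member of `T` gets `1 / |T|`
(`shapleyValue_unanimity`). Only intervals around `p` matter; with `j = p - l` and `k = x - p` this
gives `φ_i = 1 - ∑_{j ≤ p, k < n - p} (-1)^(j+k) / (j+k+1)` (`IsPathLabelling.shapleyValue_eq`).

So the program needs only `n` and the distance from `i` to one end; reversing the numbering shows
that either end will do. Walking there takes `O(n)` row scans of cost `O(n)`. At most `n²` fractions
are then added over an unreduced common denominator. Each addition multiplies by some `m ≤ n`, that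
is, performs `O(n)` machine additions. The total is in fact `O(n³)`. Large numbers cost nothing
extra, since operations have unit cost. -/

namespace PathShapley

/-! ### Labelling a linear graph by positions -/

/-- `pos` numbers the vertices of `G` consecutively along a path. -/
structure IsPathLabelling {V : Type*} [Fintype V] (G : SimpleGraph V) (pos : V → ℕ) : Prop where
  injective : Function.Injective pos
  lt_card : ∀ v, pos v < Fintype.card V
  adj_iff : ∀ u v, G.Adj u v ↔ pos u + 1 = pos v ∨ pos v + 1 = pos u

theorem IsPathLabelling.image_univ {V : Type*} [Fintype V] {G : SimpleGraph V} {pos : V → ℕ}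
    (h : IsPathLabelling G pos) :
    Finset.univ.image pos = Finset.range (Fintype.card V) := by
  apply Finset.eq_of_subset_of_card_le
  · intro x hx
    obtain ⟨v, -, rfl⟩ := Finset.mem_image.1 hx
    exact Finset.mem_range.2 (h.lt_card v)
  · rw [Finset.card_image_of_injective _ h.injective]
    simp

theorem IsPathLabelling.exists_pos_eq {V : Type*} [Fintype V] {G : SimpleGraph V} {pos : V → ℕ}
    (h : IsPathLabelling G pos) {k : ℕ} (hk : k < Fintype.card V) : ∃ v, pos v = k := by
  have : k ∈ Finset.univ.image pos := by rw [h.image_univ]; exact Finset.mem_range.2 hk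
  simpa using this

theorem IsPathLabelling.reverse {V : Type*} [Fintype V] {G : SimpleGraph V} {pos : V → ℕ}
    (h : IsPathLabelling G pos) :
    IsPathLabelling G (fun v => Fintype.card V - 1 - pos v) where
  injective u v huv := by
    have hu := h.lt_card u
    have hv := h.lt_card v
    apply h.injective
    simp only at huv
    omega
  lt_card v := by
    have hv := h.lt_card v
    omega
  adj_iff u v := by
    have hu := h.lt_card u
    have hv := h.lt_card v
    rw [h.adj_iff]
    omega

theorem exists_adj_dist_eq {V : Type*} {G : SimpleGraph V} (hG : G.Connected) {a v : V} {k : ℕ}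
    (h : G.dist a v = k + 1) : ∃ u, G.Adj u v ∧ G.dist a u = k := by
  obtain ⟨p, hp⟩ := hG.exists_walk_length_eq_dist v a
  rw [SimpleGraph.dist_comm, h] at hp
  cases p with
  | nil => simp at hp
  | @cons _ u _ hvu q =>
    refine ⟨u, hvu.symm, ?_⟩
    have h1 : G.dist a u ≤ k := by
      rw [SimpleGraph.dist_comm]
      have := SimpleGraph.dist_le q
      simp at hp
      omega
    have h2 := hG.dist_triangle (u := a) (v := u) (w := v)
    rw [SimpleGraph.dist_eq_one_iff_adj.2 hvu.symm] at h2
    omega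

/-- Induction on the distance: two vertices at distance `k + 1` share their predecessor `w`. If they
differed, `w` would have a third neighbour one step closer to `a`, or, when `w = a`, the end `a`
would have two neighbours. -/
theorem dist_injective_of_degree_le_two {V : Type*} [Fintype V] [DecidableEq V]
    {G : SimpleGraph V} [DecidableRel G.Adj] (hG : G.Connected) {a : V} (ha : G.degree a = 1)
    (hdeg : ∀ v, G.degree v ≤ 2) : Function.Injective (G.dist a) := by
  suffices H : ∀ k u v, G.dist a u = k → G.dist a v = k → u = v from
    fun u v huv => H _ u v rfl huv.symm
  intro k
  induction k with
  | zero =>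
    intro u v hu hv
    rw [hG.dist_eq_zero_iff] at hu hv
    exact hu.symm.trans hv
  | succ k ih =>
    intro u v hu hv
    obtain ⟨w, hwu, hw⟩ := exists_adj_dist_eq hG hu
    obtain ⟨w', hwv, hw'⟩ := exists_adj_dist_eq hG hv
    obtain rfl := ih w w' hw hw'
    cases k with
    | zero =>
      rw [hG.dist_eq_zero_iff] at hw
      subst hw
      obtain ⟨x, hx⟩ := Finset.card_eq_one.1 ha
      have h1 : u ∈ G.neighborFinset a := by simpa using hwu
      have h2 : v ∈ G.neighborFinset a := by simpa using hwv
      rw [hx, Finset.mem_singleton] at h1 h2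
      exact h1.trans h2.symm
    | succ m =>
      obtain ⟨x, hxw, hx⟩ := exists_adj_dist_eq hG hw
      by_contra huv
      have hxu : x ≠ u := fun h => by rw [h] at hx; omega
      have hxv : x ≠ v := fun h => by rw [h] at hx; omega
      have hsub : ({x, u, v} : Finset V) ⊆ G.neighborFinset w := by
        intro y hy
        simp only [Finset.mem_insert, Finset.mem_singleton] at hy
        rcases hy with rfl | rfl | rfl
        · simpa using hxw.symm
        · simpa using hwu
        · simpa using hwv
      have hcard := Finset.card_le_card hsub
      rw [Finset.card_eq_three.2 ⟨x, u, v, hxu, hxv, huv, rfl⟩, G.card_neighborFinset_eq_degree] at hcard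
      have := hdeg w
      omega

/-- The position is the distance from an end `a`. Adjacent vertices have distances differing by at
most one, and injectivity excludes equality; conversely a vertex has a neighbour one step closer to
`a`, and injectivity identifies it. -/
theorem IsLinearGraph.exists_labelling {V : Type*} [Fintype V] [DecidableEq V]
    {G : SimpleGraph V} [DecidableRel G.Adj] (h : IsLinearGraph G) :
    ∃ pos : V → ℕ, IsPathLabelling G pos := by
  obtain ⟨hG, a, b, -, ha, hb, hc⟩ := h
  have hdeg : ∀ v, G.degree v ≤ 2 := by
    intro v
    by_cases h1 : v = a
    · subst h1; omega
    by_cases h2 : v = b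
    · subst h2; omega
    exact (hc v h1 h2).le
  have hinj := dist_injective_of_degree_le_two hG ha hdeg
  have hback : ∀ u v, G.dist a u + 1 = G.dist a v → G.Adj u v := by
    intro u v huv
    obtain ⟨w, hw, hwu⟩ := exists_adj_dist_eq hG huv.symm
    rwa [hinj hwu] at hw
  refine ⟨G.dist a, hinj, fun v => ?_, fun u v => ⟨fun huv => ?_, ?_⟩⟩
  · obtain ⟨p, hp, hl⟩ := hG.exists_path_of_dist a v
    rw [← hl]
    exact hp.length_lt
  · have hne : G.dist a u ≠ G.dist a v := fun h => huv.ne (hinj h)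
    have := huv.diff_dist_adj (u := a)
    omega
  · rintro (h | h)
    · exact hback u v h
    · exact (hback v u h).symm

/-! ### The matching game of a path as a combination of unanimity games -/

/-- `{x - 1, x}` is an edge of the matching that scans the path from the left and takes
every edge inside `A` that it can. -/
def greedy (A : ℕ → Prop) : ℕ → Prop
  | 0 => False
  | x + 1 => A (x + 1) ∧ A x ∧ ¬ greedy A x

theorem greedy.mem {A : ℕ → Prop} {x : ℕ} (h : greedy A x) : A x := by
  cases x with
  | zero => exact h.elim
  | succ x => exact h.1

-- Both sides obey the recursion `g (x + 1) = a (x + 1) * (a x - g x)`, where `a` is the indicator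
-- of `A`: extending the intervals by `x + 1` flips all signs, and the new interval `{x, x + 1}`
-- adds the product.
open Classical in
theorem greedy_indicator (A : ℕ → Prop) (x : ℕ) :
    (if greedy A x then (1 : ℝ) else 0) =
      ∑ l ∈ Finset.range x, if ∀ y, l ≤ y → y ≤ x → A y then (-1 : ℝ) ^ (x - l + 1) else 0 := by
  induction x with
  | zero => simp [greedy]
  | succ x ih =>
    rw [Finset.sum_range_succ]
    have hterm : ∀ l ∈ Finset.range x,
        (if ∀ y, l ≤ y → y ≤ x + 1 → A y then (-1 : ℝ) ^ (x + 1 - l + 1) else 0) =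
          (if A (x + 1) then -1 else 0) *
            (if ∀ y, l ≤ y → y ≤ x → A y then (-1 : ℝ) ^ (x - l + 1) else 0) := by
      intro l hl
      have hl' := Finset.mem_range.1 hl
      have hiff : (∀ y, l ≤ y → y ≤ x + 1 → A y) ↔
          A (x + 1) ∧ ∀ y, l ≤ y → y ≤ x → A y := by
        constructor
        · intro h
          exact ⟨h _ (by omega) le_rfl, fun y h1 h2 => h y h1 (by omega)⟩
        · rintro ⟨h1, h2⟩ y hy hy'
          rcases Nat.lt_or_ge x y with h | h
          · obtain rfl : y = x + 1 := by omega
            exact h1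
          · exact h2 y hy h
      have hexp : x + 1 - l + 1 = (x - l + 1) + 1 := by omega
      simp only [hiff, hexp, pow_succ (-1 : ℝ) (x - l + 1)]
      by_cases h1 : A (x + 1) <;> by_cases h2 : ∀ y, l ≤ y → y ≤ x → A y <;> simp [h1, h2]
    rw [Finset.sum_congr rfl hterm, ← Finset.mul_sum, ← ih]
    have hlast : (∀ y, x ≤ y → y ≤ x + 1 → A y) ↔ A x ∧ A (x + 1) := by
      constructor
      · intro h
        exact ⟨h _ le_rfl (by omega), h _ (by omega) le_rfl⟩
      · rintro ⟨h1, h2⟩ y hy hy'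
        rcases Nat.lt_or_ge x y with h | h
        · obtain rfl : y = x + 1 := by omega
          exact h2
        · obtain rfl : y = x := by omega
          exact h1
    have hexp : x + 1 - x + 1 = 2 := by omega
    simp only [hlast, hexp, greedy]
    by_cases h1 : A (x + 1) <;> by_cases h2 : A x <;> by_cases h3 : greedy A x <;>
      simp [h1, h2, h3]
    exact h2 h3.mem

/-- The vertices at positions `l, …, x`. -/
def interval {V : Type*} [Fintype V] (pos : V → ℕ) (l x : ℕ) : Finset V :=
  Finset.univ.filter fun v => l ≤ pos v ∧ pos v ≤ x

theorem weight_one {V : Type*} [Fintype V] {G : SimpleGraph V} (M : G.Subgraph) :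
    weight (fun _ => 1) M = M.edgeSet.ncard := by
  classical
  simp [weight, Set.ncard_eq_toFinset_card']

/-- Weak duality: send each edge to a covering vertex on it; edges of a matching are disjoint, so
this is injective. -/
theorem matching_ncard_le_of_cover {V : Type*} [Fintype V] {G : SimpleGraph V} {M : G.Subgraph}
    (hM : M.IsMatching) (C : Finset V) (hC : ∀ u v, M.Adj u v → u ∈ C ∨ v ∈ C) :
    M.edgeSet.ncard ≤ C.card := by
  classical
  have hex : ∀ e ∈ M.edgeSet, ∃ v ∈ C, v ∈ e := by
    intro e
    induction e with
    | _ u v =>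
      intro he
      rcases hC u v he with h | h
      · exact ⟨u, h, by simp⟩
      · exact ⟨v, h, by simp⟩
  rcases M.edgeSet.eq_empty_or_nonempty with hempty | ⟨e, he⟩
  · simp [hempty]
  have : Nonempty V := ⟨(hex e he).choose⟩
  choose! f hfC hfe using hex
  rw [← Set.ncard_coe_finset C]
  refine Set.ncard_le_ncard_of_injOn f (fun e he => hfC e he) ?_ (Set.toFinite _)
  intro e he e' he' heq
  have h1 := hfe e he
  have h2 := hfe e' he'
  rw [← heq] at h2
  obtain ⟨u, hu⟩ := Sym2.mem_iff_exists.1 h1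
  obtain ⟨u', hu'⟩ := Sym2.mem_iff_exists.1 h2
  rw [hu] at he
  rw [hu'] at he'
  rw [hu, hu']
  have := hM.eq_of_adj_left (SimpleGraph.Subgraph.mem_edgeSet.1 he)
    (SimpleGraph.Subgraph.mem_edgeSet.1 he')
  rw [this]

/-- The greedy matching on the positions in `A`. -/
def greedyMatching {V : Type*} [Fintype V] {G : SimpleGraph V} {pos : V → ℕ}
    (h : IsPathLabelling G pos) (A : ℕ → Prop) : G.Subgraph where
  -- `A` may contain numbers that are no positions; the bound ensures that the right-hand partner
  -- exists.
  verts := {v | greedy A (pos v) ∨ greedy A (pos v + 1) ∧ pos v + 1 < Fintype.card V}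
  Adj u v := pos u + 1 = pos v ∧ greedy A (pos v) ∨ pos v + 1 = pos u ∧ greedy A (pos u)
  adj_sub := by
    intro u v huv
    rw [h.adj_iff]
    tauto
  edge_vert := by
    rintro u v (⟨h1, h2⟩ | ⟨h1, h2⟩)
    · exact Or.inr ⟨h1 ▸ h2, h1 ▸ h.lt_card v⟩
    · exact Or.inl h2
  symm := ⟨fun u v huv => huv.symm⟩

theorem greedyMatching_isMatching {V : Type*} [Fintype V] {G : SimpleGraph V} {pos : V → ℕ}
    (h : IsPathLabelling G pos) (A : ℕ → Prop) : (greedyMatching h A).IsMatching := by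
  have hnot : ∀ x, greedy A (x + 1) → ¬ greedy A x := fun x hx => hx.2.2
  intro v hv
  by_cases hg : greedy A (pos v)
  · have hpos : 1 ≤ pos v := by
      by_contra h0
      have : pos v = 0 := by omega
      rw [this] at hg
      exact hg
    obtain ⟨w, hw⟩ := h.exists_pos_eq (k := pos v - 1) (by have := h.lt_card v; omega)
    refine ⟨w, Or.inr ⟨by omega, hg⟩, ?_⟩
    rintro y (⟨h1, h2⟩ | ⟨h1, h2⟩)
    · exact absurd hg (hnot _ (h1 ▸ h2))
    · exact h.injective (by omega)
  · obtain ⟨h1, h2⟩ := hv.resolve_left hg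
    obtain ⟨w, hw⟩ := h.exists_pos_eq h2
    refine ⟨w, Or.inl ⟨hw.symm, hw ▸ h1⟩, ?_⟩
    rintro y (⟨h3, h4⟩ | ⟨h3, h4⟩)
    · exact h.injective (by omega)
    · exact absurd h4 hg

-- The right ends of the greedy edges certify optimality: they cover every edge inside `S`, since an
-- edge whose left end is not the right end of a greedy edge is itself taken.
open Classical in
theorem unweightedMatchingGame_eq_card_greedy {V : Type*} [Fintype V] {G : SimpleGraph V}
    {pos : V → ℕ} (h : IsPathLabelling G pos) (S : Finset V) :
    unweightedMatchingGame G S =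
      ((S.filter fun v => greedy (fun y => ∃ u ∈ S, pos u = y) (pos v)).card : ℝ) := by
  set A : ℕ → Prop := fun y => ∃ u ∈ S, pos u = y with hA
  set C := S.filter fun v => greedy A (pos v) with hCdef
  have hmem : ∀ v, A (pos v) → v ∈ S := by
    rintro v ⟨u, hu, huv⟩
    rwa [← h.injective huv]
  have hgr := matchingGame_isGreatest G (fun _ => 1) S
  apply le_antisymm
  · obtain ⟨M, hM, hMS, hw⟩ := hgr.1
    rw [unweightedMatchingGame, hw, weight_one]
    norm_cast
    apply matching_ncard_le_of_cover hM
    have key : ∀ u v, M.Adj u v → pos u + 1 = pos v → u ∈ C ∨ v ∈ C := by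
      intro u v huv hp
      have hu : u ∈ S := hMS huv.fst_mem
      have hv : v ∈ S := hMS huv.snd_mem
      by_cases hg : greedy A (pos u)
      · exact Or.inl (Finset.mem_filter.2 ⟨hu, hg⟩)
      · refine Or.inr (Finset.mem_filter.2 ⟨hv, ?_⟩)
        rw [← hp]
        exact ⟨⟨v, hv, hp.symm⟩, ⟨u, hu, rfl⟩, hg⟩
    intro u v huv
    rcases (h.adj_iff u v).1 huv.adj_sub with hp | hp
    · exact key u v huv hp
    · exact (key v u huv.symm hp).symm
  · refine le_trans ?_ (hgr.2 ⟨greedyMatching h A, greedyMatching_isMatching h A, ?_, rfl⟩)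
    · rw [weight_one]
      norm_cast
      have hpred : ∀ v ∈ (C : Set V), ∃ u, pos u + 1 = pos v := by
        intro v hv
        have hg := (Finset.mem_filter.1 hv).2
        cases hx : pos v with
        | zero => rw [hx] at hg; exact hg.elim
        | succ k =>
          obtain ⟨u, hu⟩ := h.exists_pos_eq (k := k) (by have := h.lt_card v; omega)
          exact ⟨u, by omega⟩
      choose! f hf using hpred
      rw [← Set.ncard_coe_finset C]
      refine Set.ncard_le_ncard_of_injOn (fun v => s(f v, v)) ?_ ?_ (Set.toFinite _)
      · intro v hv
        exact Or.inl ⟨hf v hv, (Finset.mem_filter.1 hv).2⟩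
      · intro u hu v hv huv
        have h1 := hf u hu
        have h2 := hf v hv
        simp only [Sym2.eq_iff] at huv
        rcases huv with ⟨-, h3⟩ | ⟨h3, h4⟩
        · exact h3
        · rw [h3] at h1
          rw [← h4] at h2
          omega
    · rintro v (hv | ⟨hv, -⟩)
      · exact hmem v hv.mem
      · exact hmem v hv.2.1

open Classical in
theorem unweightedMatchingGame_eq_sum {V : Type*} [Fintype V] {G : SimpleGraph V}
    {pos : V → ℕ} (h : IsPathLabelling G pos) (S : Finset V) :
    unweightedMatchingGame G S =
      ∑ x ∈ Finset.range (Fintype.card V), ∑ l ∈ Finset.range x,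
        (-1 : ℝ) ^ (x - l + 1) * if interval pos l x ⊆ S then 1 else 0 := by
  rw [unweightedMatchingGame_eq_card_greedy h]
  set A : ℕ → Prop := fun y => ∃ u ∈ S, pos u = y with hA
  have h1 : (S.filter fun v => greedy A (pos v)).card =
      ((Finset.range (Fintype.card V)).filter (greedy A)).card := by
    rw [← Finset.card_image_of_injective _ h.injective]
    congr 1
    ext x
    simp only [Finset.mem_image, Finset.mem_filter, Finset.mem_range]
    constructor
    · rintro ⟨v, ⟨-, hv⟩, rfl⟩
      exact ⟨h.lt_card v, hv⟩
    · rintro ⟨-, hx⟩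
      obtain ⟨u, hu, rfl⟩ := hx.mem
      exact ⟨u, ⟨hu, hx⟩, rfl⟩
  rw [h1, Finset.card_filter]
  push_cast
  refine Finset.sum_congr rfl fun x hx => ?_
  rw [greedy_indicator]
  refine Finset.sum_congr rfl fun l _ => ?_
  have hiff : (∀ y, l ≤ y → y ≤ x → A y) ↔ interval pos l x ⊆ S := by
    constructor
    · intro hy v hv
      simp only [interval, Finset.mem_filter, Finset.mem_univ, true_and] at hv
      obtain ⟨u, hu, huv⟩ := hy _ hv.1 hv.2
      rwa [← h.injective huv]
    · intro hsub y hly hyx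
      obtain ⟨v, rfl⟩ := h.exists_pos_eq (k := y) (by have := Finset.mem_range.1 hx; omega)
      exact ⟨v, hsub (by simp [interval, hly, hyx]), rfl⟩
  simp only [hiff, mul_ite, mul_one, mul_zero]

theorem IsPathLabelling.card_interval {V : Type*} [Fintype V] {G : SimpleGraph V} {pos : V → ℕ}
    (h : IsPathLabelling G pos) {l x : ℕ} (hx : x < Fintype.card V) :
    (interval pos l x).card = x + 1 - l := by
  rw [← Finset.card_image_of_injective _ h.injective, ← Nat.card_Icc]
  congr 1
  ext y
  simp only [interval, Finset.mem_image, Finset.mem_filter, Finset.mem_univ, true_and,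
    Finset.mem_Icc]
  constructor
  · rintro ⟨v, hv, rfl⟩
    exact hv
  · intro hy
    obtain ⟨v, rfl⟩ := h.exists_pos_eq (k := y) (by omega)
    exact ⟨v, hy, rfl⟩

/-! ### The Shapley value of a unanimity game -/

/-- Each summand is `r! t! (m + t).choose t`, so the hockey-stick identity applies. -/
theorem sum_choose_factorial (t r : ℕ) :
    (t + 1) * ∑ m ∈ Finset.range (r + 1), r.choose m * ((t + m).factorial * (r - m).factorial) =
      (t + r + 1).factorial := by
  have hterm : ∀ m ∈ Finset.range (r + 1),
      r.choose m * ((t + m).factorial * (r - m).factorial) =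
        r.factorial * t.factorial * (m + t).choose t := by
    intro m hm
    have hm' : m ≤ r := by have := Finset.mem_range.1 hm; omega
    rw [← Nat.choose_mul_factorial_mul_factorial hm', add_comm t m,
      ← Nat.add_choose_mul_factorial_mul_factorial m t]
    ring
  rw [Finset.sum_congr rfl hterm, ← Finset.mul_sum, Nat.sum_range_add_choose]
  have h := Nat.add_choose_mul_factorial_mul_factorial r (t + 1)
  rw [show t + r + 1 = r + (t + 1) by ring, ← h, Nat.factorial_succ t,
    show r + t + 1 = r + (t + 1) by ring]
  ring

/-- For a further player `i`, the sum counts the orderings of `U ∪ {i}` in which `i` comes after all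
of `T`, with `S` the set before `i`; this is a fraction `1 / (|T| + 1)` of all orderings. -/
theorem sum_powerset_factorial {V : Type*} [DecidableEq V] {T U : Finset V} (hTU : T ⊆ U) :
    (T.card + 1) * ∑ S ∈ U.powerset,
        (if T ⊆ S then S.card.factorial * (U.card - S.card).factorial else 0) =
      (U.card + 1).factorial := by
  have hIcc : U.powerset.filter (T ⊆ ·) = Finset.Icc T U := by
    ext S
    simp [Finset.mem_Icc, and_comm]
  rw [← Finset.sum_filter, hIcc, Finset.Icc_eq_image_powerset hTU, Finset.sum_image]
  · have hcard := Finset.card_sdiff_add_card_eq_card hTU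
    set r := (U \ T).card with hr
    have hterm : ∀ S ∈ (U \ T).powerset,
        (T ∪ S).card.factorial * (U.card - (T ∪ S).card).factorial =
          (T.card + S.card).factorial * (r - S.card).factorial := by
      intro S hS
      have hd : Disjoint T S :=
        Finset.disjoint_of_subset_right (Finset.mem_powerset.1 hS) Finset.disjoint_sdiff
      rw [Finset.card_union_of_disjoint hd, ← hcard]
      congr 2
      omega
    rw [Finset.sum_congr rfl hterm, Finset.sum_powerset_apply_card
      (fun m => (T.card + m).factorial * (r - m).factorial), ← hr]
    simp only [smul_eq_mul]
    rw [sum_choose_factorial, ← hcard, add_comm r]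
  · intro S hS S' hS' heq
    have hd : ∀ S ∈ (((U \ T).powerset : Finset (Finset V)) : Set (Finset V)),
        (T ∪ S) \ T = S := by
      intro S hS
      rw [Finset.union_sdiff_left]
      exact Finset.sdiff_eq_self_of_disjoint
        (Finset.disjoint_of_subset_left (Finset.mem_powerset.1 hS) Finset.sdiff_disjoint)
    rw [← hd S hS, ← hd S' hS']
    exact congrArg (· \ T) heq

theorem shapleyValue_unanimity {V : Type*} [Fintype V] [DecidableEq V] (T : Finset V) (i : V) :
    shapleyValue (fun S => if T ⊆ S then (1 : ℝ) else 0) i =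
      if i ∈ T then 1 / (T.card : ℝ) else 0 := by
  have hV : 0 < Fintype.card V := Fintype.card_pos_iff.2 ⟨i⟩
  unfold shapleyValue
  split_ifs with hi
  · set U := Finset.univ.erase i with hU
    have hUc : U.card = Fintype.card V - 1 := by simp [hU]
    have hsub : T.erase i ⊆ U := Finset.erase_subset_erase _ (Finset.subset_univ _)
    have hmain := sum_powerset_factorial hsub
    rw [Finset.card_erase_add_one hi, hUc, Nat.sub_add_cancel hV] at hmain
    have hterm : ∀ S ∈ U.powerset,
        (S.card.factorial : ℝ) * ((Fintype.card V - S.card - 1).factorial : ℝ) *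
          ((if T ⊆ insert i S then 1 else 0) - if T ⊆ S then 1 else 0) =
        ((if T.erase i ⊆ S then
          S.card.factorial * (Fintype.card V - 1 - S.card).factorial else 0 : ℕ) : ℝ) := by
      intro S hS
      have hiS : i ∉ S := fun h => by
        have := Finset.mem_powerset.1 hS h
        simp [hU] at this
      have h1 : ¬ T ⊆ S := fun h => hiS (h hi)
      simp only [Nat.sub_right_comm, Finset.subset_insert_iff, if_neg h1]
      split_ifs <;> simp
    rw [Finset.sum_congr rfl hterm, ← Nat.cast_sum, ← hmain]
    have hT : (T.card : ℝ) ≠ 0 := by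
      have := Finset.card_pos.2 ⟨i, hi⟩
      positivity
    have hF : ((Fintype.card V).factorial : ℝ) ≠ 0 := by positivity
    rw [← hmain] at hF
    push_cast at hF ⊢
    rw [div_eq_div_iff hF hT]
    ring
  · rw [Finset.sum_eq_zero, zero_div]
    intro S _
    simp only [Finset.subset_insert_iff_of_notMem hi, sub_self, mul_zero]

theorem shapleyValue_sum {V ι : Type*} [Fintype V] [DecidableEq V] (s : Finset ι) (c : ι → ℝ)
    (v : ι → Finset V → ℝ) (i : V) :
    shapleyValue (fun S => ∑ k ∈ s, c k * v k S) i = ∑ k ∈ s, c k * shapleyValue (v k) i := by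
  unfold shapleyValue
  simp only [← Finset.sum_sub_distrib, ← mul_sub, Finset.mul_sum, Finset.sum_div, mul_div_assoc']
  rw [Finset.sum_comm]
  refine Finset.sum_congr rfl fun k _ => Finset.sum_congr rfl fun S _ => ?_
  ring

/-! ### A closed formula -/

/-- The alternating sum `∑_{j < a, k < b} (-1) ^ (j + k) / (j + k + 1)`. -/
noncomputable def altSum (a b : ℕ) : ℝ :=
  ∑ j ∈ Finset.range a, ∑ k ∈ Finset.range b, (-1 : ℝ) ^ (j + k) / ((j + k + 1 : ℕ) : ℝ)

theorem sum_intervals_eq (n p : ℕ) (hp : p < n) :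
    (∑ x ∈ Finset.range n, ∑ l ∈ Finset.range x,
      (-1 : ℝ) ^ (x - l + 1) * if l ≤ p ∧ p ≤ x then 1 / ((x + 1 - l : ℕ) : ℝ) else 0) =
      1 - altSum (p + 1) (n - p) := by
  obtain ⟨b, rfl⟩ : ∃ b, n = p + (b + 1) := ⟨n - p - 1, by omega⟩
  have hrow : ∀ k, (∑ l ∈ Finset.range (p + k),
      (-1 : ℝ) ^ (p + k - l + 1) *
        if l ≤ p ∧ p ≤ p + k then 1 / ((p + k + 1 - l : ℕ) : ℝ) else 0) =
      (if k = 0 then 1 else 0) -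
        ∑ j ∈ Finset.range (p + 1), (-1 : ℝ) ^ (j + k) / ((j + k + 1 : ℕ) : ℝ) := by
    intro k
    rw [← Finset.sum_range_reflect
      (fun j => (-1 : ℝ) ^ (j + k) / ((j + k + 1 : ℕ) : ℝ)) (p + 1)]
    have hrefl : ∀ j ∈ Finset.range (p + 1),
        (-1 : ℝ) ^ (p + 1 - 1 - j + k) / ((p + 1 - 1 - j + k + 1 : ℕ) : ℝ) =
          -((-1 : ℝ) ^ (p + k - j + 1) *
            if j ≤ p ∧ p ≤ p + k then 1 / ((p + k + 1 - j : ℕ) : ℝ) else 0) := by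
      intro j hj
      have hj' := Finset.mem_range.1 hj
      rw [if_pos (by omega), show p + 1 - 1 - j + k = p + k - j by omega,
        show p + k - j + 1 = p + k + 1 - j by omega,
        show p + k + 1 - j = (p + k - j) + 1 by omega, pow_succ]
      ring
    rw [Finset.sum_congr rfl hrefl, Finset.sum_neg_distrib, sub_neg_eq_add]
    -- In the row `k = 0` the singleton `l = x = p` is missing from the left side; its term would be
    -- `-1`, which accounts for the `1`.
    cases k with
    | zero =>
      rw [Finset.sum_range_succ]
      simp
    | succ k =>
      rw [if_neg (by omega), zero_add]
      symm
      apply Finset.sum_subset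
      · intro x
        simp only [Finset.mem_range]
        omega
      · intro x _ hx
        rw [if_neg (by simp only [Finset.mem_range] at hx; omega), mul_zero]
  rw [Finset.sum_range_add, Finset.sum_eq_zero, zero_add, Finset.sum_congr rfl fun k _ => hrow k,
    Finset.sum_sub_distrib, Finset.sum_range_succ', altSum, Finset.sum_comm,
    show p + (b + 1) - p = b + 1 by omega]
  · simp
  · intro x hx
    apply Finset.sum_eq_zero
    intro l _
    have := Finset.mem_range.1 hx
    rw [if_neg (by omega), mul_zero]

theorem IsPathLabelling.shapleyValue_eq {V : Type*} [Fintype V] [DecidableEq V]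
    {G : SimpleGraph V} {pos : V → ℕ} (h : IsPathLabelling G pos) (i : V) :
    shapleyValue (unweightedMatchingGame G) i =
      1 - altSum (pos i + 1) (Fintype.card V - pos i) := by
  have hv : unweightedMatchingGame G = fun S =>
      ∑ x ∈ Finset.range (Fintype.card V), 1 * ∑ l ∈ Finset.range x,
        (-1 : ℝ) ^ (x - l + 1) * if interval pos l x ⊆ S then 1 else 0 := by
    funext S
    rw [unweightedMatchingGame_eq_sum h]
    simp only [one_mul]
    congr!
  rw [hv, shapleyValue_sum, ← sum_intervals_eq _ _ (h.lt_card i)]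
  refine Finset.sum_congr rfl fun x hx => ?_
  rw [one_mul, shapleyValue_sum]
  refine Finset.sum_congr rfl fun l _ => ?_
  rw [shapleyValue_unanimity, h.card_interval (Finset.mem_range.1 hx)]
  simp [interval]

/-- Needed because the machine only has truncated subtraction: it makes the final numerator exact.
-/
theorem shapleyValue_unweightedMatchingGame_nonneg {V : Type*} [Fintype V] [DecidableEq V]
    (G : SimpleGraph V) (i : V) : 0 ≤ shapleyValue (unweightedMatchingGame G) i := by
  unfold shapleyValue
  refine div_nonneg (Finset.sum_nonneg fun S _ => mul_nonneg (by positivity) ?_) (by positivity)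
  obtain ⟨M, hM, hMS, hw⟩ := (matchingGame_isGreatest G (fun _ => 1) S).1
  rw [sub_nonneg, unweightedMatchingGame, hw]
  refine (matchingGame_isGreatest G (fun _ => 1) (insert i S)).2 ⟨M, hM, hMS.trans ?_, rfl⟩
  simp

/-! ### Total correctness with a clock -/

/-- Started in `σ` at time `t`, the program `p` halts in a state and at a time satisfying `Q`. -/
def Runs (p : Prog) (Q : State → ℕ → Prop) (σ : State) (t : ℕ) : Prop :=
  ∃ τ s, Exec p σ τ s ∧ Q τ (t + s)

theorem State.setReg_reg (σ : State) (d x r : ℕ) :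
    (σ.setReg d x).reg r = if r = d then x else σ.reg r := by
  simp [State.setReg, Function.update_apply]

theorem State.setReg_mem (σ : State) (d x : ℕ) : (σ.setReg d x).mem = σ.mem := rfl

theorem State.ext {σ τ : State} (h1 : ∀ r, σ.reg r = τ.reg r) (h2 : σ.mem = τ.mem) : σ = τ := by
  cases σ
  cases τ
  simp only at h2
  subst h2
  congr 1
  exact funext h1

section Rules

variable {Q : State → ℕ → Prop} {σ : State} {t : ℕ}

/-- These equivalences let `simp` execute loop-free code symbolically; only loops need an invariant.
-/
theorem runs_skip : Runs .skip Q σ t ↔ Q σ (t + 1) :=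
  ⟨fun ⟨_, _, h, hQ⟩ => by cases h; exact hQ, fun h => ⟨_, _, .skip σ, h⟩⟩

theorem runs_const {d c : ℕ} : Runs (.const d c) Q σ t ↔ Q (σ.setReg d c) (t + 1) :=
  ⟨fun ⟨_, _, h, hQ⟩ => by cases h; exact hQ, fun h => ⟨_, _, .const σ d c, h⟩⟩

theorem runs_add {d a b : ℕ} :
    Runs (.add d a b) Q σ t ↔ Q (σ.setReg d (σ.reg a + σ.reg b)) (t + 1) :=
  ⟨fun ⟨_, _, h, hQ⟩ => by cases h; exact hQ, fun h => ⟨_, _, .add σ d a b, h⟩⟩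

theorem runs_sub {d a b : ℕ} :
    Runs (.sub d a b) Q σ t ↔ Q (σ.setReg d (σ.reg a - σ.reg b)) (t + 1) :=
  ⟨fun ⟨_, _, h, hQ⟩ => by cases h; exact hQ, fun h => ⟨_, _, .sub σ d a b, h⟩⟩

theorem runs_load {d a : ℕ} :
    Runs (.load d a) Q σ t ↔ Q (σ.setReg d (σ.mem (σ.reg a))) (t + 1) :=
  ⟨fun ⟨_, _, h, hQ⟩ => by cases h; exact hQ, fun h => ⟨_, _, .load σ d a, h⟩⟩

theorem runs_seq {p q : Prog} :
    Runs (.seq p q) Q σ t ↔ Runs p (fun τ s => Runs q Q τ s) σ t := by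
  constructor
  · rintro ⟨_, _, h, hQ⟩
    cases h with
    | seq h1 h2 => exact ⟨_, _, h1, _, _, h2, by rwa [add_assoc]⟩
  · rintro ⟨_, _, h1, _, _, h2, hQ⟩
    exact ⟨_, _, .seq h1 h2, by rwa [← add_assoc]⟩

theorem runs_ite {a : ℕ} {p q : Prog} :
    Runs (.ite a p q) Q σ t ↔
      (σ.reg a ≠ 0 → Runs p Q σ (t + 1)) ∧ (σ.reg a = 0 → Runs q Q σ (t + 1)) := by
  constructor
  · rintro ⟨_, _, h, hQ⟩
    cases h with
    | ite_true h1 h2 =>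
      exact ⟨fun _ => ⟨_, _, h2, by rwa [add_right_comm]⟩, fun h => absurd h h1⟩
    | ite_false h1 h2 =>
      exact ⟨fun h => absurd h1 h, fun _ => ⟨_, _, h2, by rwa [add_right_comm]⟩⟩
  · rintro ⟨h1, h2⟩
    by_cases h : σ.reg a = 0
    · obtain ⟨_, _, h3, hQ⟩ := h2 h
      exact ⟨_, _, .ite_false h h3, by rwa [← add_assoc, add_right_comm]⟩
    · obtain ⟨_, _, h3, hQ⟩ := h1 h
      exact ⟨_, _, .ite_true h h3, by rwa [← add_assoc, add_right_comm]⟩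

/-- A loop whose invariant `I k` means that exactly `k` rounds, of at most `B` steps, remain. -/
theorem runs_loop {a : ℕ} {p : Prog} (I : ℕ → State → Prop) (B : ℕ)
    (hstep : ∀ k σ t, I (k + 1) σ → σ.reg a ≠ 0 ∧ Runs p (fun τ s => I k τ ∧ s ≤ t + B) σ t)
    (hzero : ∀ σ, I 0 σ → σ.reg a = 0) (k : ℕ) (hI : I k σ)
    (hQ : ∀ τ s, I 0 τ → s ≤ t + (k * (B + 1) + 1) → Q τ s) : Runs (.loop a p) Q σ t := by
  induction k generalizing σ t with
  | zero => exact ⟨_, _, .loop_done (hzero σ hI), hQ _ _ hI (by omega)⟩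
  | succ k ih =>
    obtain ⟨hne, τ, s, h1, hτ, hs⟩ := hstep k σ t hI
    obtain ⟨υ, s', h2, hυ⟩ := ih (σ := τ) (t := t + s + 1) hτ (fun υ u hυ hu => hQ υ u hυ (by
      rw [add_mul]
      omega))
    exact ⟨υ, _, .loop_step hne h1 h2, by
      rwa [show t + (s + s' + 1) = t + s + 1 + s' by ring]⟩

end Rules

/-! ### The program -/

/-- `R_d := R_a * R_b` by repeated addition, with the counter `R_c`, provided that
`R_2 = 1` and `R_3 = 0`. -/
def mulProg (d a b c : ℕ) : Prog :=
  .seq (.const d 0) <| .seq (.add c b 3) <| .loop c (.seq (.add d d a) (.sub c c 2))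

/-- The time depends on the factor in `R_b` alone, so huge numerators and denominators are harmless
as the other factor. -/
theorem runs_mulProg {Q : State → ℕ → Prop} {σ : State} {t d a b c : ℕ} (h2 : σ.reg 2 = 1)
    (h3 : σ.reg 3 = 0) (hd : d ≠ a ∧ d ≠ b ∧ d ≠ c ∧ d ≠ 2 ∧ d ≠ 3) (hc : c ≠ a ∧ c ≠ 2)
    (hQ : ∀ s, s ≤ t + 3 * σ.reg b + 3 →
      Q ((σ.setReg d (σ.reg a * σ.reg b)).setReg c 0) s) :
    Runs (mulProg d a b c) Q σ t := by
  simp only [mulProg, runs_seq, runs_const, runs_add]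
  obtain ⟨hda, hdb, hdc, hd2, hd3⟩ := hd
  obtain ⟨hca, hc2⟩ := hc
  refine runs_loop (fun k τ => k ≤ σ.reg b ∧
    τ = (σ.setReg d (σ.reg a * (σ.reg b - k))).setReg c k) 2 ?_ ?_ (σ.reg b) ?_ ?_
  · rintro k τ u ⟨hk, rfl⟩
    simp only [runs_seq, runs_add, runs_sub]
    refine ⟨by simp [State.setReg_reg], ⟨by omega, ?_⟩, by omega⟩
    apply State.ext
    · intro r
      have hmul : σ.reg a * (σ.reg b - k) =
          σ.reg a * (σ.reg b - (k + 1)) + σ.reg a := by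
        rw [← Nat.mul_succ]
        congr 1
        omega
      simp only [State.setReg_reg, hmul]
      by_cases hrc : r = c
      · simp [hrc, hdc.symm, hc2.symm, hd2.symm, h2]
      · by_cases hrd : r = d
        · simp [hrd, hdc, hda.symm, hca.symm]
        · simp [hrc, hrd]
    · simp [State.setReg_mem]
  · rintro τ ⟨-, rfl⟩
    simp [State.setReg_reg]
  · refine ⟨le_rfl, ?_⟩
    simp [State.setReg_reg, hdb.symm, hd3.symm, h3]
  · rintro τ s ⟨-, rfl⟩ hs
    rw [Nat.sub_zero]
    exact hQ s (by omega)

/-- Test whether `v = R_8 - 1` is a neighbour of `R_4` other than `R_5`; if so, put it into `R_11`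
and set the flag `R_12`. -/
def scanBody : Prog :=
  .seq (.sub 8 8 2) <| .seq (.add 9 7 8) <| .seq (.load 9 9) <|
  .ite 9
    (.seq (.sub 9 8 5) <| .seq (.sub 10 5 8) <| .seq (.add 9 9 10) <|
      .ite 9 (.seq (.add 11 8 3) (.const 12 1)) .skip)
    .skip

/-- Move from the vertex `R_4`, reached from `R_5`, one step further along the path and count the
step in `R_6`; the flag `R_12` tells whether there was a further vertex. -/
def walkStep : Prog :=
  .seq (mulProg 7 4 0 8) <| .seq (.const 12 0) <| .seq (.add 8 0 3) <| .seq (.loop 8 scanBody) <|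
  .ite 12 (.seq (.add 5 4 3) <| .seq (.add 4 11 3) (.add 6 6 2)) .skip

/-- Add `± 1 / R_16` to `(R_13 - R_14) / R_15` with the sign given by `R_18`, and advance. -/
def accumulate : Prog :=
  .seq (mulProg 23 13 16 22) <| .seq (mulProg 24 14 16 22) <|
  .seq (.ite 18 (.add 23 23 15) (.add 24 24 15)) <|
  .seq (mulProg 25 15 16 22) <|
  .seq (.add 13 23 3) <| .seq (.add 14 24 3) <| .seq (.add 15 25 3) <|
  .seq (.add 16 16 2) <| .seq (.sub 18 2 18) (.sub 21 21 2)

/-- Accumulate one row of the alternating double sum. -/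
def accumulateRow : Prog :=
  .seq (.add 16 17 3) <| .seq (.add 18 19 3) <| .seq (.sub 21 0 6) <|
  .seq (.loop 21 accumulate) <|
  .seq (.add 17 17 2) <| .seq (.sub 19 2 19) (.sub 20 20 2)

/-- The algorithm for the Shapley value in the matching game of a linear graph. -/
def shapleyProg : Prog :=
  .seq (.const 2 1) <| .seq (.add 4 1 3) <| .seq (.add 5 0 3) <|
  .seq walkStep <| .seq (.loop 12 walkStep) <|
  .seq (.const 13 0) <| .seq (.const 14 0) <| .seq (.const 15 1) <|
  .seq (.const 17 1) <| .seq (.const 19 1) <| .seq (.add 20 6 2) <|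
  .seq (.loop 20 accumulateRow) <|
  .seq (.add 14 14 15) <| .seq (.sub 0 14 13) (.add 1 15 3)

/-! ### Walking along the path -/

/-- The registers during the walk: at `cur`, coming from `prev`, after `cnt` steps. -/
structure WalkState (μ : ℕ → ℕ) (n cur prev cnt : ℕ) (σ : State) : Prop where
  mem : σ.mem = μ
  reg0 : σ.reg 0 = n
  reg2 : σ.reg 2 = 1
  reg3 : σ.reg 3 = 0
  reg4 : σ.reg 4 = cur
  reg5 : σ.reg 5 = prev
  reg6 : σ.reg 6 = cnt

/-- The registers inside the scan for a next vertex, with the vertices `< k` still to be tested. -/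
structure ScanState (μ : ℕ → ℕ) (n cur prev cnt k : ℕ) (σ : State) : Prop
    extends WalkState μ n cur prev cnt σ where
  le : k ≤ n
  reg7 : σ.reg 7 = cur * n
  reg8 : σ.reg 8 = k
  flag : (σ.reg 12 = 0 ∧ ∀ v, k ≤ v → v < n → ¬ (μ (cur * n + v) ≠ 0 ∧ v ≠ prev)) ∨
    (σ.reg 12 = 1 ∧ σ.reg 11 < n ∧ μ (cur * n + σ.reg 11) ≠ 0 ∧ σ.reg 11 ≠ prev)

theorem runs_scanBody {μ : ℕ → ℕ} {n cur prev cnt k : ℕ} {σ : State} {t : ℕ}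
    (h : ScanState μ n cur prev cnt (k + 1) σ) :
    Runs scanBody (fun τ s => ScanState μ n cur prev cnt k τ ∧ s ≤ t + 10) σ t := by
  have hle := h.le
  have hskip : ¬ (μ (cur * n + k) ≠ 0 ∧ k ≠ prev) →
      (σ.reg 12 = 0 ∧ ∀ v, k ≤ v → v < n → ¬ (μ (cur * n + v) ≠ 0 ∧ v ≠ prev)) ∨
      (σ.reg 12 = 1 ∧ σ.reg 11 < n ∧ μ (cur * n + σ.reg 11) ≠ 0 ∧ σ.reg 11 ≠ prev) := by
    intro hk
    refine h.flag.imp_left fun ⟨h1, h2⟩ => ⟨h1, fun v hv hvn => ?_⟩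
    rcases hv.eq_or_lt with rfl | hv
    · exact hk
    · exact h2 v hv hvn
  simp only [scanBody, runs_seq, runs_sub, runs_add, runs_load, runs_ite, runs_const, runs_skip]
  simp [State.setReg_reg, State.setReg_mem, h.mem, h.reg2, h.reg3, h.reg5, h.reg7, h.reg8]
  refine ⟨fun hk => ⟨fun hne => ?_, fun h1 h2 => ?_⟩, fun hk => ?_⟩
  · refine ⟨?_, by omega, ?_, ?_, Or.inr ?_⟩
    · constructor <;> simp [State.setReg_reg, State.setReg_mem, h.mem, h.reg0, h.reg2, h.reg3,
        h.reg4, h.reg5, h.reg6]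
    · simp [State.setReg_reg, h.reg7]
    · simp [State.setReg_reg]
    · simp [State.setReg_reg, hk]
      omega
  · refine ⟨?_, by omega, ?_, ?_, ?_⟩
    · constructor <;> simp [State.setReg_reg, State.setReg_mem, h.mem, h.reg0, h.reg2, h.reg3,
        h.reg4, h.reg5, h.reg6]
    · simp [State.setReg_reg, h.reg7]
    · simp [State.setReg_reg]
    · simpa [State.setReg_reg] using hskip (by omega)
  · refine ⟨?_, by omega, ?_, ?_, ?_⟩
    · constructor <;> simp [State.setReg_reg, State.setReg_mem, h.mem, h.reg0, h.reg2, h.reg3,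
        h.reg4, h.reg5, h.reg6]
    · simp [State.setReg_reg, h.reg7]
    · simp [State.setReg_reg]
    · simpa [State.setReg_reg] using hskip (by simp [hk])

/-- The bound is `3n + 3` for the row offset, `11n + 1` for the scan and `6` for the remaining
instructions. -/
theorem runs_walkStep {Q : State → ℕ → Prop} {μ : ℕ → ℕ} {n cur prev cnt : ℕ} {σ : State} {t : ℕ}
    (h : WalkState μ n cur prev cnt σ)
    (hend : ∀ τ s, s ≤ t + (14 * n + 10) → τ.reg 12 = 0 → WalkState μ n cur prev cnt τ →
      (∀ v, v < n → ¬ (μ (cur * n + v) ≠ 0 ∧ v ≠ prev)) → Q τ s)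
    (hnext : ∀ τ s v, s ≤ t + (14 * n + 10) → τ.reg 12 = 1 → v < n →
      μ (cur * n + v) ≠ 0 → v ≠ prev → WalkState μ n v cur (cnt + 1) τ → Q τ s) :
    Runs walkStep Q σ t := by
  simp only [walkStep, runs_seq]
  refine runs_mulProg h.reg2 h.reg3 (by decide) (by decide) fun s hs => ?_
  rw [h.reg0] at hs
  simp only [runs_const, runs_add]
  refine runs_loop (ScanState μ n cur prev cnt) 10
    (fun k τ u hτ => ⟨by rw [hτ.reg8]; omega, runs_scanBody hτ⟩) (fun τ hτ => hτ.reg8) n ?_ ?_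
  · refine ⟨?_, le_rfl, ?_, ?_, Or.inl ⟨?_, fun v h1 h2 => by omega⟩⟩
    · constructor <;> simp [State.setReg_reg, State.setReg_mem, h.mem, h.reg0, h.reg2, h.reg3,
        h.reg4, h.reg5, h.reg6]
    · simp [State.setReg_reg, h.reg0, h.reg4]
    · simp [State.setReg_reg, h.reg0, h.reg3]
    · simp [State.setReg_reg]
  · intro τ u hτ hu
    simp only [runs_ite, runs_seq, runs_add, runs_skip]
    rcases hτ.flag with ⟨h0, hnone⟩ | ⟨h1, hlt, hadj, hne⟩
    · refine ⟨fun hx => absurd h0 hx, fun _ => ?_⟩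
      exact hend _ _ (by omega) h0 hτ.toWalkState fun v hv => hnone v (Nat.zero_le v) hv
    · refine ⟨fun _ => ?_, fun hx => by omega⟩
      refine hnext _ _ _ (by omega) ?_ hlt hadj hne ?_
      · simpa [State.setReg_reg] using h1
      · constructor <;> simp [State.setReg_reg, State.setReg_mem, hτ.mem, hτ.reg0, hτ.reg2,
          hτ.reg3, hτ.reg4, hτ.reg6]

theorem inputState_mem_ne_zero {n : ℕ} (G : SimpleGraph (Fin n)) [DecidableRel G.Adj] (i u v : Fin n) :
    (inputState G i).mem (u * n + v) ≠ 0 ↔ G.Adj u v := by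
  simp only [inputState, ne_eq, ite_eq_right_iff, one_ne_zero, imp_false, not_not]
  constructor
  · rintro ⟨u', v', h, hadj⟩
    have hn : 0 < n := u.pos
    have hu := congrArg (· / n) h
    have hv := congrArg (· % n) h
    simp only [Nat.add_comm _ (v : ℕ), Nat.add_comm _ (v' : ℕ), Nat.add_mul_div_right _ _ hn,
      Nat.add_mul_mod_self_right, Nat.div_eq_of_lt v.isLt, Nat.div_eq_of_lt v'.isLt,
      Nat.mod_eq_of_lt v.isLt, Nat.mod_eq_of_lt v'.isLt, zero_add] at hu hv
    rwa [Fin.ext hu, Fin.ext hv]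
  · exact fun h => ⟨u, v, rfl, h⟩

theorem runs_loop_walkStep {n : ℕ} {G : SimpleGraph (Fin n)} [DecidableRel G.Adj] {pos : Fin n → ℕ}
    (hpos : IsPathLabelling G pos) {i v : Fin n} (hv : pos v + 1 = pos i) {Q : State → ℕ → Prop}
    {σ : State} {t : ℕ} (h : WalkState (inputState G i).mem n v i 1 σ) (hflag : σ.reg 12 = 1)
    (hQ : ∀ τ s, s ≤ t + (n * (14 * n + 11) + 1) → τ.reg 0 = n → τ.reg 2 = 1 → τ.reg 3 = 0 →
      τ.reg 6 = pos i → Q τ s) :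
    Runs (.loop 12 walkStep) Q σ t := by
  have hlt : ∀ v, pos v < n := by simpa using hpos.lt_card
  -- While the flag is set, `pos u + 1` rounds remain: one per step down to position `0` and one
  -- that finds no further vertex and clears the flag.
  refine runs_loop (fun k τ => ∃ u w : Fin n, ∃ cnt,
    WalkState (inputState G i).mem n u w cnt τ ∧ pos u + 1 = pos w ∧ cnt + pos u = pos i ∧
      ((k = pos u + 1 ∧ τ.reg 12 = 1) ∨ (k = 0 ∧ pos u = 0 ∧ τ.reg 12 = 0)))
    (14 * n + 10) ?_ ?_ (pos v + 1) ⟨v, i, 1, h, hv, by omega, Or.inl ⟨rfl, hflag⟩⟩ ?_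
  · rintro k τ s ⟨u, w, cnt, hτ, huw, hcnt, ⟨hk, hf⟩ | ⟨hk, -⟩⟩
    swap
    · omega
    obtain rfl : k = pos u := by omega
    refine ⟨by omega, runs_walkStep hτ ?_ ?_⟩
    · intro τ' s' hs' hf' hτ' hnone
      refine ⟨⟨u, w, cnt, hτ', huw, hcnt, Or.inr ?_⟩, hs'⟩
      suffices pos u = 0 from ⟨this, this, hf'⟩
      by_contra h0
      obtain ⟨x, hx⟩ := hpos.exists_pos_eq (k := pos u - 1) (by
        have := hpos.lt_card u
        omega)
      refine hnone x x.isLt ⟨(inputState_mem_ne_zero G i u x).2 ?_, ?_⟩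
      · rw [hpos.adj_iff]
        omega
      · intro hxw
        rw [Fin.ext hxw] at hx
        omega
    · intro τ' s' x hs' hf' hx hadj hne hτ'
      have hadj' := (inputState_mem_ne_zero G i u ⟨x, hx⟩).1 hadj
      rw [hpos.adj_iff] at hadj'
      have hxu : pos ⟨x, hx⟩ + 1 = pos u := by
        refine hadj'.resolve_left fun h1 => hne ?_
        rw [← hpos.injective (h1.symm.trans huw)]
      exact ⟨⟨⟨x, hx⟩, u, cnt + 1, hτ', hxu, by omega, Or.inl ⟨by omega, hf'⟩⟩, hs'⟩
  · rintro τ ⟨u, w, cnt, -, -, -, ⟨hk, -⟩ | ⟨-, -, hf⟩⟩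
    · omega
    · exact hf
  · rintro τ s ⟨u, w, cnt, hτ, -, hcnt, ⟨hk, -⟩ | ⟨-, h0, -⟩⟩ hs
    · omega
    · refine hQ τ s (hs.trans ?_) hτ.reg0 hτ.reg2 hτ.reg3 (by rw [hτ.reg6]; omega)
      rw [hv]
      exact Nat.add_le_add_left
        (Nat.add_le_add_right (Nat.mul_le_mul_right (14 * n + 11) (hlt i).le) 1) t

/-! ### Summing up -/

/-- The registers while the alternating sum is accumulated; `x` is the value of the sum so far. -/
structure AccState (n L j r : ℕ) (x : ℝ) (σ : State) : Prop where
  reg0 : σ.reg 0 = n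
  reg2 : σ.reg 2 = 1
  reg3 : σ.reg 3 = 0
  reg6 : σ.reg 6 = L
  reg17 : σ.reg 17 = j + 1
  reg19 : σ.reg 19 = (j + 1) % 2
  reg20 : σ.reg 20 = r
  reg15 : σ.reg 15 ≠ 0
  value : (σ.reg 13 : ℝ) - σ.reg 14 = σ.reg 15 * x

/-- The registers inside a row, before the `k`-th summand with `r'` summands to go. -/
structure RowState (n L j r k r' : ℕ) (x : ℝ) (σ : State) : Prop
    extends AccState n L j r x σ where
  reg16 : σ.reg 16 = j + k + 1
  reg18 : σ.reg 18 = (j + k + 1) % 2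
  reg21 : σ.reg 21 = r'

theorem runs_accumulate {n L j r k r' : ℕ} {x : ℝ} {σ : State} {t : ℕ}
    (h : RowState n L j r k (r' + 1) x σ) (hjk : j + k < n) :
    Runs accumulate (fun τ s => RowState n L j r (k + 1) r'
      (x + (-1 : ℝ) ^ (j + k) / ((j + k + 1 : ℕ) : ℝ)) τ ∧ s ≤ t + (9 * n + 20)) σ t := by
  have hm : ((j + k + 1 : ℕ) : ℝ) ≠ 0 := by positivity
  have hval := h.value
  simp only [accumulate, runs_seq]
  refine runs_mulProg h.reg2 h.reg3 (by decide) (by decide) fun s1 hs1 => ?_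
  refine runs_mulProg (by simp [State.setReg_reg, h.reg2]) (by simp [State.setReg_reg, h.reg3])
    (by decide) (by decide) fun s2 hs2 => ?_
  simp [State.setReg_reg, h.reg16] at hs1 hs2
  simp only [runs_ite, runs_add]
  constructor
  all_goals
    intro hs
    simp [State.setReg_reg, h.reg18] at hs
    refine runs_mulProg (by simp [State.setReg_reg, h.reg2]) (by simp [State.setReg_reg, h.reg3])
      (by decide) (by decide) fun s3 hs3 => ?_
    simp [State.setReg_reg, h.reg16] at hs3
    simp only [runs_sub]
    refine ⟨⟨?_, ?_, ?_, ?_⟩, by omega⟩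
    · constructor
      case value =>
        simp [State.setReg_reg, h.reg16, h.reg3]
        push_cast at hm
        field_simp
        -- The branch taken on `R_18` fixes the parity of `j + k`, so exactly one of the two signs
        -- can be justified.
        first
        | rw [Even.neg_one_pow (Nat.even_iff.2 (by omega))]; linear_combination (j + k + 1 : ℝ) * hval
        | rw [Odd.neg_one_pow (Nat.odd_iff.2 (by omega))]; linear_combination (j + k + 1 : ℝ) * hval
      case reg15 => simp [State.setReg_reg, h.reg15, h.reg16, h.reg3]
      all_goals simp [State.setReg_reg, h.reg0, h.reg2, h.reg3, h.reg6, h.reg17, h.reg19, h.reg20]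
    · simp [State.setReg_reg, h.reg16, h.reg2]
      omega
    · simp [State.setReg_reg, h.reg18, h.reg2]
      omega
    · simp [State.setReg_reg, h.reg21, h.reg2]

theorem runs_accumulateRow {n L j r : ℕ} {x : ℝ} {σ : State} {t : ℕ}
    (h : AccState n L j (r + 1) x σ) (hj : j ≤ L) (hL : L < n) :
    Runs accumulateRow (fun τ s => AccState n L (j + 1) r
      (x + ∑ k ∈ Finset.range (n - L), (-1 : ℝ) ^ (j + k) / ((j + k + 1 : ℕ) : ℝ)) τ ∧
        s ≤ t + (n * (9 * n + 21) + 7)) σ t := by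
  simp only [accumulateRow, runs_seq, runs_add, runs_sub]
  refine runs_loop (fun r' τ => ∃ k, k + r' = n - L ∧ RowState n L j (r + 1) k r'
    (x + ∑ k ∈ Finset.range k, (-1 : ℝ) ^ (j + k) / ((j + k + 1 : ℕ) : ℝ)) τ)
    (9 * n + 20) ?_ ?_ (n - L) ⟨0, by omega, ?_⟩ ?_
  · rintro r' τ u ⟨k, hk, hτ⟩
    refine ⟨by rw [hτ.reg21]; omega, ?_⟩
    obtain ⟨τ', s, h1, h2, h3⟩ := runs_accumulate (t := u) hτ (by omega)
    refine ⟨τ', s, h1, ⟨k + 1, by omega, ?_⟩, h3⟩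
    rwa [Finset.sum_range_succ, ← add_assoc]
  · rintro τ ⟨k, hk, hτ⟩
    exact hτ.reg21
  · have hval := h.value
    refine ⟨?_, ?_, ?_, ?_⟩
    · constructor
      case value => simpa [State.setReg_reg] using hval
      case reg15 => simp [State.setReg_reg, h.reg15]
      all_goals simp [State.setReg_reg, h.reg0, h.reg2, h.reg3, h.reg6, h.reg17, h.reg19, h.reg20]
    · simp [State.setReg_reg, h.reg17, h.reg3]
    · simp [State.setReg_reg, h.reg19, h.reg3]
    · simp [State.setReg_reg, h.reg0, h.reg6]
  · rintro τ s ⟨k, hk, hτ⟩ hs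
    obtain rfl : k = n - L := by omega
    have hval := hτ.value
    constructor
    · constructor
      case value => simpa [State.setReg_reg] using hval
      case reg15 => simp [State.setReg_reg, hτ.reg15]
      case reg19 =>
        simp [State.setReg_reg, hτ.reg19, hτ.reg2]
        omega
      all_goals simp [State.setReg_reg, hτ.reg0, hτ.reg2, hτ.reg3, hτ.reg6, hτ.reg17, hτ.reg20]
    · have hs' : s ≤ t + 1 + 1 + 1 + ((n - L) * (9 * n + 21) + 1) := hs
      have := Nat.mul_le_mul_right (9 * n + 21) (Nat.sub_le n L)
      omega

theorem runs_loop_accumulateRow {n L : ℕ} (hL : L < n) {Q : State → ℕ → Prop} {σ : State} {t : ℕ}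
    (h : AccState n L 0 (L + 1) 0 σ)
    (hQ : ∀ τ s, AccState n L (L + 1) 0 (altSum (L + 1) (n - L)) τ →
      s ≤ t + (n * (n * (9 * n + 21) + 8) + 1) → Q τ s) :
    Runs (.loop 20 accumulateRow) Q σ t := by
  refine runs_loop (fun r τ => ∃ j, j + r = L + 1 ∧ AccState n L j r (altSum j (n - L)) τ)
    (n * (9 * n + 21) + 7) ?_ ?_ (L + 1) ⟨0, by omega, by simpa [altSum] using h⟩ ?_
  · rintro r τ u ⟨j, hj, hτ⟩
    refine ⟨by rw [hτ.reg20]; omega, ?_⟩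
    obtain ⟨τ', s, h1, h2, h3⟩ := runs_accumulateRow (t := u) hτ (by omega) hL
    refine ⟨τ', s, h1, ⟨j + 1, by omega, ?_⟩, h3⟩
    rwa [altSum, Finset.sum_range_succ]
  · rintro τ ⟨j, hj, hτ⟩
    exact hτ.reg20
  · rintro τ s ⟨j, hj, hτ⟩ hs
    obtain rfl : j = L + 1 := by omega
    have hs' : s ≤ t + ((L + 1) * (n * (9 * n + 21) + 8) + 1) := by
      rwa [Nat.add_assoc _ 7 1] at hs
    have := Nat.mul_le_mul_right (n * (9 * n + 21) + 8) (show L + 1 ≤ n from hL)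
    exact hQ τ s hτ (by omega)

/-! ### The algorithm is correct and fast -/

theorem IsPathLabelling.exists_pos_succ_eq {V : Type*} [Fintype V] {G : SimpleGraph V}
    {pos : V → ℕ} (h : IsPathLabelling G pos) {i v : V} (hiv : G.Adj i v) :
    ∃ pos' : V → ℕ, IsPathLabelling G pos' ∧ pos' v + 1 = pos' i := by
  rcases (h.adj_iff i v).1 hiv with h1 | h1
  · refine ⟨_, h.reverse, ?_⟩
    have hv := h.lt_card v
    change Fintype.card V - 1 - pos v + 1 = Fintype.card V - 1 - pos i
    omega
  · exact ⟨pos, h, h1⟩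

theorem runs_shapleyProg {n : ℕ} {G : SimpleGraph (Fin n)} [DecidableRel G.Adj]
    (hG : IsLinearGraph G) (i : Fin n) :
    Runs shapleyProg (fun τ s => Outputs τ (shapleyValue (unweightedMatchingGame G) i) ∧
      s ≤ 100 * n ^ 4) (inputState G i) 0 := by
  obtain ⟨pos₀, hpos₀⟩ := hG.exists_labelling
  obtain ⟨w, hw⟩ : ∃ w, G.Adj i w := by
    obtain ⟨hconn, a, b, hab, -⟩ := hG
    have : Nontrivial (Fin n) := ⟨a, b, hab⟩
    exact hconn.preconnected.exists_adj_of_nontrivial i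
  simp only [shapleyProg, runs_seq, runs_const, runs_add, runs_sub]
  -- The predecessor `n` is not a vertex, so no neighbour of `i` is excluded from the first step.
  refine runs_walkStep (μ := (inputState G i).mem) (n := n) (cur := i) (prev := n) (cnt := 0)
    ?_ ?_ ?_
  · constructor <;> simp [State.setReg_reg, State.setReg_mem, inputState]
  · intro τ s _ _ _ hnone
    exact absurd ⟨(inputState_mem_ne_zero G i i w).2 hw, w.isLt.ne⟩ (hnone w w.isLt)
  intro τ₁ s₁ v hs₁ hflag hv hadj _ hτ₁
  -- The direction of the numbering is chosen only now, so that the walk, wherever it went, is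
  -- heading for position `0`.
  obtain ⟨pos, hpos, hvi⟩ :=
    hpos₀.exists_pos_succ_eq ((inputState_mem_ne_zero G i i ⟨v, hv⟩).1 hadj)
  have hlt : pos i < n := by simpa using hpos.lt_card i
  refine runs_loop_walkStep hpos hvi hτ₁ hflag fun τ₂ s₂ hs₂ h0 h2 h3 h6 => ?_
  refine runs_loop_accumulateRow (n := n) (L := pos i) hlt ?_ ?_
  · constructor <;> simp [State.setReg_reg, h0, h2, h3, h6]
  intro τ₃ s₃ hτ₃ hs₃
  have hval := hτ₃.value
  have hφ := hpos.shapleyValue_eq i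
  rw [Fintype.card_fin] at hφ
  have hD : (τ₃.reg 15 : ℝ) ≠ 0 := by exact_mod_cast hτ₃.reg15
  have hDφ : (τ₃.reg 14 : ℝ) + τ₃.reg 15 - τ₃.reg 13 =
      τ₃.reg 15 * shapleyValue (unweightedMatchingGame G) i := by
    rw [hφ]
    linear_combination -hval
  have hle : τ₃.reg 13 ≤ τ₃.reg 14 + τ₃.reg 15 := by
    have h1 := mul_nonneg (Nat.cast_nonneg (α := ℝ) (τ₃.reg 15))
      (shapleyValue_unweightedMatchingGame_nonneg G i)
    rw [← hDφ, sub_nonneg] at h1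
    exact_mod_cast h1
  refine ⟨⟨?_, ?_⟩, ?_⟩
  · simpa [State.setReg_reg, hτ₃.reg3] using hτ₃.reg15
  · simp [State.setReg_reg, hτ₃.reg3]
    rw [eq_div_iff hD, Nat.cast_sub hle]
    push_cast
    linear_combination -hDφ
  -- The steps add up to at most `9n³ + 35n² + 33n + 24`. The coefficients sum to 101, so the
  -- constant 100 also uses `n ≥ 2`, which follows from `hvi` and `hlt`.
  · have hn : 1 ≤ n := by omega
    have h1 : n ≤ n ^ 4 := Nat.le_self_pow (by norm_num) n
    have h2 : n ^ 2 ≤ n ^ 4 := Nat.pow_le_pow_right hn (by norm_num)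
    have h3 : n ^ 3 ≤ n ^ 4 := Nat.pow_le_pow_right hn (by norm_num)
    ring_nf at hs₁ hs₂ hs₃ ⊢
    omega

end PathShapley

theorem mainTheorem7 :
    ∃ (p : PathShapley.Prog) (C : ℕ),
      ∀ (n : ℕ) (G : SimpleGraph (Fin n)) [DecidableRel G.Adj],
        PathShapley.IsLinearGraph G →
          ∀ i : Fin n, ∃ (τ : PathShapley.State) (t : ℕ),
            PathShapley.Exec p (PathShapley.inputState G i) τ t ∧
              t ≤ C * n ^ 4 ∧
              PathShapley.Outputs τ
                (PathShapley.shapleyValue (PathShapley.unweightedMatchingGame G) i) := by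
  refine ⟨PathShapley.shapleyProg, 100, fun n G _ hG i => ?_⟩
  obtain ⟨τ, t, hexec, hout, ht⟩ := PathShapley.runs_shapleyProg hG i
  exact ⟨τ, t, hexec, by simpa using ht, hout⟩
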